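/- Let $n\ge 0$ be an integer and $c>0$. For $f:\mathbb{R}^n\to\mathbb{R}\cup\{+\infty\}$ write $f^*(y)=\sup_{x}\,(x\cdot y-f(x))$. Let $\mathcal F(\mathbb{R}^n)$ be the set of convex, lower semicontinuous functions $f:\mathbb{R}^n\to\mathbb{R}\cup\{+\infty\}$ that take at least one finite value, and let $\mathcal V(\mathbb{R}^n)$ be the set of convex functions $V:\mathbb{R}^n\to\mathbb{R}$ such that $V^*$ is also finite everywhere. For $V\in\mathcal V(\mathbb{R}^n)$ let $\eta(dx)=\frac1Z e^{-V}dx$ and $\eta^*(dx)=\frac1{Z^*}e^{-V^*}dx$, where $Z=\int e^{-V}dx$ and $Z^*=\int e^{-V^*}dx$, and let $\nu=\nabla V\#\eta$ and $\nu^*=\nabla V^*\#\eta^*$ be their moment measures (pushforwards under the gradients). Let $H(\eta)=\int\log\frac{d\eta}{dx}\,d\eta$ and $$\mathcal T(\mu_1,\mu_2)=\inf_{f\in\mathcal F(\mathbb{R}^n)}\Big\{\int f\,d\mu_1+\int f^*\,d\mu_2\Big\}.$$ Consider, for $V\in\mathcal V(\mathbb{R}^n)$, the inequality $$H(\eta)+H(\eta^*)\le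 -n\log(ce^2)+\mathcal T(\nu,\nu^*).\tag{1}$$ (a) If $V\in\mathcal V(\mathbb{R}^n)$ satisfies (1), then $\int e^{-V}dx\int e^{-V^*}dx\ge c^n$. (b) If (1) holds for every $V\in\mathcal V(\mathbb{R}^n)$, then $$\int e^{-f}dx\int e^{-f^*}dx\ge c^n\tag{2}$$ for every $f\in\mathcal F(\mathbb{R}^n)$ such that both integrals are positive (they may be infinite). (c) If (1) holds for every even $V\in\mathcal V(\mathbb{R}^n)$, then (2) holds for every even $f\in\mathcal F(\mathbb{R}^n)$ such that both integrals are positive. -/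

import Mathlib

open MeasureTheory

noncomputable section

namespace EntropyTransport

/-- Euclidean space `ℝⁿ`, with its Euclidean inner product and Lebesgue measure `volume`. -/
abbrev Rn (n : ℕ) : Type := EuclideanSpace ℝ (Fin n)

/-- Convexity of an extended-real-valued function: its epigraph is a convex set. -/
def IsConvexFn {n : ℕ} (f : Rn n → EReal) : Prop :=
  Convex ℝ {p : Rn n × ℝ | f p.1 ≤ (p.2 : EReal)}

/-- The Fenchel-Legendre transform `f*(y) = sup_x (⟨x, y⟩ - f x)`. -/
def conj {n : ℕ} (f : Rn n → EReal) (y : Rn n) : EReal :=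
  ⨆ x : Rn n, ((inner ℝ x y : ℝ) : EReal) - f x

/-- The class `ℱ(ℝⁿ)` of functions `ℝⁿ → ℝ ∪ {+∞}` that are convex, lower semicontinuous and
proper (finite at some point). -/
def classF (n : ℕ) : Set (Rn n → EReal) :=
  {f | (∀ x, f x ≠ ⊥) ∧ IsConvexFn f ∧ LowerSemicontinuous f ∧ ∃ x, f x ≠ ⊤}

/-- The class `𝒱(ℝⁿ)` of convex functions `V` such that `V` and `V*` are everywhere finite. -/
def classV (n : ℕ) : Set (Rn n → EReal) :=
  {V | IsConvexFn V ∧ (∀ x, V x ≠ ⊥ ∧ V x ≠ ⊤) ∧ ∀ y, conj V y ≠ ⊥ ∧ conj V y ≠ ⊤}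

/-- Symmetric (even) functions. -/
def IsEven {n : ℕ} (f : Rn n → EReal) : Prop := ∀ x, f (-x) = f x

/-- `∫ e^{-f} dx`, as an element of `[0, +∞]` (with `e^{-∞} = 0`). -/
def expInt {n : ℕ} (f : Rn n → EReal) : ENNReal :=
  ∫⁻ x, EReal.exp (-f x)

/-- The measure `η(dx) = Z⁻¹ e^{-V} dx` with `Z = ∫ e^{-V} dx`. -/
def gibbs {n : ℕ} (V : Rn n → EReal) : Measure (Rn n) :=
  (expInt V)⁻¹ • (volume : Measure (Rn n)).withDensity (fun x => EReal.exp (-V x))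

/-- The moment measure of `η(dx) = Z⁻¹ e^{-V} dx`: the pushforward of `η` under the gradient of `V`
(the gradient exists at almost every point where `V` is finite and is a measurable function). -/
def momentMeasure {n : ℕ} (V : Rn n → EReal) : Measure (Rn n) :=
  (gibbs V).map (fun x => gradient (fun z => (V z).toReal) x)

/-- The integral of an extended-real-valued function, integral of the positive part minus
integral of the negative part. -/
def eintegral {n : ℕ} (f : Rn n → EReal) (μ : Measure (Rn n)) : EReal :=
  ((∫⁻ x, (f x).toENNReal ∂μ : ENNReal) : EReal) -
    ((∫⁻ x, (-f x).toENNReal ∂μ : ENNReal) : EReal)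

/-- The entropy `H(η) = ∫ log (dη/dx) dη` of an absolutely continuous measure `η`, relative to
Lebesgue measure. -/
def entropy {n : ℕ} (η : Measure (Rn n)) : EReal :=
  eintegral (fun x => ENNReal.log (η.rnDeriv volume x)) η

/-- The maximal correlation cost `𝒯(μ₁, μ₂) = inf_{f ∈ ℱ(ℝⁿ)} (∫ f dμ₁ + ∫ f* dμ₂)`. -/
def maxCorr {n : ℕ} (μ₁ μ₂ : Measure (Rn n)) : EReal :=
  ⨅ f ∈ classF n, eintegral f μ₁ + eintegral (conj f) μ₂

/-- The Entropy-Transport inequality `H(η) + H(η*) ≤ -n log (c e²) + 𝒯(ν, ν*)` for the potentials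
`V` and `V*`. -/
def EntropyTransportIneq {n : ℕ} (c : ℝ) (V : Rn n → EReal) : Prop :=
  entropy (gibbs V) + entropy (gibbs (conj V)) ≤
    ((-(n : ℝ) * Real.log (c * Real.exp 2) : ℝ) : EReal) +
      maxCorr (momentMeasure V) (momentMeasure (conj V))

/-- The inverse Santaló inequality `IS_n(c)`. -/
def InverseSantalo (n : ℕ) (c : ℝ) : Prop :=
  ∀ f ∈ classF n, 0 < expInt f → 0 < expInt (conj f) →
    ENNReal.ofReal (c ^ n) ≤ expInt f * expInt (conj f)

/-- The inverse Santaló inequality for even functions, `IS_{n,s}(c)`. -/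
def InverseSantaloSymm (n : ℕ) (c : ℝ) : Prop :=
  ∀ f ∈ classF n, IsEven f → 0 < expInt f → 0 < expInt (conj f) →
    ENNReal.ofReal (c ^ n) ≤ expInt f * expInt (conj f)

end EntropyTransport

end

/-!
# From the Entropy-Transport inequality to the inverse Santaló inequality

*One potential.* Let `V` and `V*` be finite. The conjugate `V*` is a competitor in `𝒯(ν, ν*)`, and
`V*(∇V(x)) = ⟨∇V(x), x⟩ - V(x)` wherever `V` is differentiable (`conj_gradient`), hence almost
everywhere. Since `∫ ⟨∇V, x⟩ e^{-V} ≤ n ∫ e^{-V}` (`integrable_inner_gradient_mul_exp_neg`), this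
gives `𝒯(ν, ν*) ≤ 2n - ∫ V dη - ∫ V* dη*`. On the other side `H(η) = -log Z - ∫ V dη`
(`entropy_gibbs`), and the same for `η*`. All potential energies are finite because `V*` finite
forces `V` to grow at least linearly, so they cancel, and `Z Z* ≥ cⁿ` remains
(`le_expInt_mul_expInt_conj`).

*All of `ℱ`.* Let both integrals be positive; if one of them is infinite there is nothing to prove.
With `g = f*` and `q = |·|²`, the function `f_ε = (g + εq)* + εq` is finite with finite conjugate,
and is even if `f` is. It satisfies `f_ε ≥ (g + εq)*` and `f_ε* ≥ (f + εq)*`. As `ε ↓ 0` these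
lower bounds increase to `g* = f` (Fenchel–Moreau, `conj_conj`) and to `f*`. Both integrals being
positive and finite, `0` is interior to the domains of `f` and `g` (`zero_mem_interior_dom`), so
the lower bounds grow linearly, uniformly in `ε`, and their exponential integrals converge
(`tendsto_expInt_conj_addSq`). The bound for `f_ε` therefore passes to `f`.
-/

open MeasureTheory Filter Topology Set
open scoped ENNReal InnerProductSpace

noncomputable section

namespace EntropyTransport

variable {n : ℕ}

/-! ### Conjugates, the Fenchel–Moreau theorem and quadratic regularization -/

lemma conj_le_coe_iff {f : Rn n → EReal} {y : Rn n} {M : ℝ} :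
    conj f y ≤ M ↔ ∀ (z : Rn n) (t : ℝ), f z ≤ t → ⟪z, y⟫_ℝ - t ≤ M := by
  unfold conj
  rw [iSup_le_iff]
  refine forall_congr' fun z => ?_
  induction h : f z with
  | bot =>
    simp only [EReal.sub_bot (EReal.coe_ne_bot _), top_le_iff, EReal.coe_ne_top, bot_le,
      forall_const, false_iff, not_forall]
    exact ⟨⟪z, y⟫_ℝ - M - 1, by linarith⟩
  | coe r =>
    norm_cast
    exact ⟨fun h t ht => by linarith, fun h => h r le_rfl⟩
  | top => simp

lemma le_conj {f : Rn n → EReal} {z y : Rn n} {t : ℝ} (h : f z ≤ t) :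
    ((⟪z, y⟫_ℝ - t : ℝ) : EReal) ≤ conj f y := by
  refine le_trans ?_ (le_iSup (fun x : Rn n => ((inner ℝ x y : ℝ) : EReal) - f x) z)
  rw [EReal.coe_sub]
  exact EReal.sub_le_sub le_rfl h

lemma exists_le_coe {a : EReal} (h : a ≠ ⊤) : ∃ t : ℝ, a ≤ t := by
  induction a with
  | bot => exact ⟨0, bot_le⟩
  | coe r => exact ⟨r, le_rfl⟩
  | top => exact absurd rfl h

lemma conj_ne_bot {f : Rn n → EReal} {z : Rn n} (h : f z ≠ ⊤) (y : Rn n) : conj f y ≠ ⊥ := by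
  obtain ⟨t, ht⟩ := exists_le_coe h
  exact ne_bot_of_le_ne_bot (EReal.coe_ne_bot _) (le_conj (y := y) ht)

lemma conj_antitone {f g : Rn n → EReal} (h : ∀ x, f x ≤ g x) (y : Rn n) :
    conj g y ≤ conj f y :=
  iSup_mono fun x => EReal.sub_le_sub le_rfl (h x)

lemma isConvexFn_conj (f : Rn n → EReal) : IsConvexFn (conj f) := by
  intro p hp q hq a b ha hb hab
  simp only [mem_ofPred_eq, conj_le_coe_iff] at hp hq ⊢
  intro z t hz
  have h1 := mul_le_mul_of_nonneg_left (hp z t hz) ha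
  have h2 := mul_le_mul_of_nonneg_left (hq z t hz) hb
  have h3 : t = a * t + b * t := by rw [← add_mul, hab, one_mul]
  simp only [Prod.fst_add, Prod.smul_fst, Prod.snd_add, Prod.smul_snd, inner_add_right,
    inner_smul_right, smul_eq_mul]
  linarith

lemma lowerSemicontinuous_conj (f : Rn n → EReal) : LowerSemicontinuous (conj f) := by
  refine lowerSemicontinuous_iSup fun z => Continuous.lowerSemicontinuous ?_
  induction f z with
  | bot => simpa [EReal.sub_bot (EReal.coe_ne_bot _)] using continuous_const
  | coe r =>
    simp only [← EReal.coe_sub]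
    exact continuous_coe_real_ereal.comp (by fun_prop)
  | top => simpa using continuous_const

lemma measurable_conj (f : Rn n → EReal) : Measurable (conj f) :=
  (lowerSemicontinuous_conj f).measurable

lemma IsEven.conj {f : Rn n → EReal} (hf : IsEven f) : IsEven (conj f) := by
  intro y
  unfold EntropyTransport.conj
  rw [← (Equiv.neg (Rn n)).iSup_comp]
  simp [hf _]

lemma conj_conj_le (f : Rn n → EReal) (x : Rn n) : conj (conj f) x ≤ f x := by
  rw [← EReal.le_of_forall_lt_iff_le]
  intro t ht
  rw [conj_le_coe_iff]
  intro y s hs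
  have := conj_le_coe_iff.1 hs x t ht.le
  rw [real_inner_comm] at this
  linarith

/-- A point `(x, r)` strictly below the graph of a closed convex function `f` with an affine
minorant is strictly below an affine minorant of `f`. A separating hyperplane in `ℝⁿ × ℝ` gives
it; when this hyperplane is vertical, a large multiple of it is added to the given minorant. -/
lemma exists_conj_le_of_lt {f : Rn n → EReal} (hf : f ∈ classF n) {y₀ : Rn n}
    (hy₀ : conj f y₀ ≠ ⊤) {x : Rn n} {r : ℝ} (hr : (r : EReal) < f x) :
    ∃ (u : Rn n) (s : ℝ), conj f u ≤ s ∧ r ≤ ⟪u, x⟫_ℝ - s := by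
  obtain ⟨-, hconv, hlsc, z₀, hz₀⟩ := hf
  have hclosed : IsClosed {p : Rn n × ℝ | f p.1 ≤ (p.2 : EReal)} :=
    hlsc.isClosed_epigraph.preimage
      (continuous_fst.prodMk (continuous_coe_real_ereal.comp continuous_snd))
  have hnot : (x, r) ∉ {p : Rn n × ℝ | f p.1 ≤ (p.2 : EReal)} := by simpa using hr
  obtain ⟨L, s, hL, hs⟩ := geometric_hahn_banach_closed_point hconv hclosed hnot
  set u : Rn n := (InnerProductSpace.toDual ℝ (Rn n)).symm
    (L.comp (ContinuousLinearMap.inl ℝ (Rn n) ℝ)) with hu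
  set α : ℝ := L (0, 1) with hα
  have hLe : ∀ z t, L (z, t) = ⟪u, z⟫_ℝ + t * α := by
    intro z t
    have h1 : ((z, t) : Rn n × ℝ) = (z, 0) + t • (0, 1) := by simp
    rw [h1, map_add, map_smul, hu, InnerProductSpace.toDual_symm_apply]
    simp [hα]
  simp only [mem_ofPred_eq, Prod.forall, hLe] at hL hs
  obtain ⟨t₀, ht₀⟩ := exists_le_coe hz₀
  have hα0 : α ≤ 0 := by
    by_contra! h
    have h1 := hL z₀ (max t₀ ((s - ⟪u, z₀⟫_ℝ) / α))
      (ht₀.trans (EReal.coe_le_coe_iff.2 (le_max_left _ _)))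
    have h2 : (s - ⟪u, z₀⟫_ℝ) / α * α ≤ max t₀ ((s - ⟪u, z₀⟫_ℝ) / α) * α :=
      mul_le_mul_of_nonneg_right (le_max_right _ _) h.le
    rw [div_mul_cancel₀ _ h.ne'] at h2
    linarith
  rcases hα0.lt_or_eq with hneg | hzero
  · have hb : 0 < -α := by linarith
    refine ⟨(-α)⁻¹ • u, (-α)⁻¹ * s, conj_le_coe_iff.2 fun z t hz => ?_, ?_⟩
    · have h1 := mul_le_mul_of_nonneg_left (hL z t hz).le (inv_nonneg.2 hb.le)
      have h2 : (-α)⁻¹ * (t * α) = -t := by have := hneg.ne; field_simp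
      rw [inner_smul_right, real_inner_comm]
      linarith
    · have h1 := mul_le_mul_of_nonneg_left hs.le (inv_nonneg.2 hb.le)
      have h2 : (-α)⁻¹ * (r * α) = -r := by have := hneg.ne; field_simp
      rw [real_inner_smul_left]
      linarith
  · obtain ⟨s₀, hs₀⟩ := exists_le_coe hy₀
    rw [hzero] at hL hs
    have hd : 0 < ⟪u, x⟫_ℝ - s := by linarith
    set l : ℝ := max 0 ((r + s₀ - ⟪y₀, x⟫_ℝ) / (⟪u, x⟫_ℝ - s)) with hl
    have hl0 : 0 ≤ l := le_max_left _ _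
    refine ⟨y₀ + l • u, s₀ + l * s, conj_le_coe_iff.2 fun z t hz => ?_, ?_⟩
    · have h1 := conj_le_coe_iff.1 hs₀ z t hz
      have h2 := mul_le_mul_of_nonneg_left (hL z t hz).le hl0
      rw [inner_add_right, inner_smul_right, real_inner_comm u z]
      linarith
    · have h1 : (r + s₀ - ⟪y₀, x⟫_ℝ) / (⟪u, x⟫_ℝ - s) * (⟪u, x⟫_ℝ - s) ≤
          l * (⟪u, x⟫_ℝ - s) := mul_le_mul_of_nonneg_right (le_max_right _ _) hd.le
      rw [div_mul_cancel₀ _ hd.ne'] at h1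
      rw [inner_add_left, real_inner_smul_left]
      linarith

/-- The Fenchel–Moreau theorem. -/
theorem conj_conj {f : Rn n → EReal} (hf : f ∈ classF n) {y₀ : Rn n} (hy₀ : conj f y₀ ≠ ⊤) :
    conj (conj f) = f := by
  funext x
  refine le_antisymm (conj_conj_le f x) ?_
  rw [← EReal.ge_of_forall_gt_iff_ge]
  intro r hr
  obtain ⟨u, s, hus, hrs⟩ := exists_conj_le_of_lt hf hy₀ hr
  exact (EReal.coe_le_coe_iff.2 hrs).trans (le_conj hus)

/-- The function `f + ε|·|²`. -/
def addSq (ε : ℝ) (f : Rn n → EReal) (x : Rn n) : EReal := f x + ((ε * ‖x‖ ^ 2 : ℝ) : EReal)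

lemma addSq_le_coe_iff {ε : ℝ} {f : Rn n → EReal} {x : Rn n} {t : ℝ} :
    addSq ε f x ≤ t ↔ f x ≤ ((t - ε * ‖x‖ ^ 2 : ℝ) : EReal) := by
  unfold addSq
  induction f x with
  | bot => simp
  | coe r => norm_cast; exact le_sub_iff_add_le.symm
  | top => simp only [EReal.top_add_coe, top_le_iff, EReal.coe_ne_top]

lemma addSq_ne_top {f : Rn n → EReal} {x : Rn n} (ε : ℝ) (h : f x ≠ ⊤) : addSq ε f x ≠ ⊤ :=
  EReal.add_ne_top h (EReal.coe_ne_top _)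

lemma addSq_ne_bot {f : Rn n → EReal} {x : Rn n} (ε : ℝ) (h : f x ≠ ⊥) : addSq ε f x ≠ ⊥ :=
  by
  rw [addSq, Ne, EReal.add_eq_bot_iff]
  exact not_or.2 ⟨h, EReal.coe_ne_bot _⟩

lemma IsEven.addSq {f : Rn n → EReal} (hf : IsEven f) (ε : ℝ) : IsEven (addSq ε f) := by
  intro x
  simp [EntropyTransport.addSq, hf x]

lemma IsConvexFn.addSq {f : Rn n → EReal} (hf : IsConvexFn f) {ε : ℝ} (hε : 0 ≤ ε) :
    IsConvexFn (addSq ε f) := by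
  intro p hp q hq a b ha hb hab
  simp only [mem_ofPred_eq, addSq_le_coe_iff] at hp hq ⊢
  have h := hf (x := (p.1, p.2 - ε * ‖p.1‖ ^ 2)) hp (y := (q.1, q.2 - ε * ‖q.1‖ ^ 2)) hq ha hb hab
  refine (mem_ofPred_eq ▸ h : _ ≤ _).trans (EReal.coe_le_coe_iff.2 ?_)
  have hsq : ‖a • p.1 + b • q.1‖ ^ 2 ≤ a * ‖p.1‖ ^ 2 + b * ‖q.1‖ ^ 2 := by
    have := ((convexOn_norm (convex_univ (E := Rn n) (𝕜 := ℝ))).pow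
      (fun x _ => norm_nonneg x) 2).2 (mem_univ p.1) (mem_univ q.1) ha hb hab
    simpa using this
  have := mul_le_mul_of_nonneg_left hsq hε
  simp only [Prod.fst_add, Prod.smul_fst, Prod.snd_add, Prod.smul_snd, smul_eq_mul]
  linarith

/-- Adding `ε|·|²` to a function with an affine minorant makes its conjugate finite everywhere. -/
lemma conj_addSq_ne_top {f : Rn n → EReal} {y₀ : Rn n} (hy₀ : conj f y₀ ≠ ⊤) {ε : ℝ}
    (hε : 0 < ε) (y : Rn n) : conj (addSq ε f) y ≠ ⊤ := by
  obtain ⟨s, hs⟩ := exists_le_coe hy₀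
  refine ne_top_of_le_ne_top (EReal.coe_ne_top (‖y - y₀‖ ^ 2 / (4 * ε) + s))
    (conj_le_coe_iff.2 fun z t hz => ?_)
  have h1 := conj_le_coe_iff.1 hs z _ (addSq_le_coe_iff.1 hz)
  have h2 : ⟪z, y⟫_ℝ = ⟪z, y₀⟫_ℝ + ⟪z, y - y₀⟫_ℝ := by rw [← inner_add_right]; simp
  have h3 : ⟪z, y - y₀⟫_ℝ ≤ ‖z‖ * ‖y - y₀‖ := real_inner_le_norm _ _
  have h4 : ‖z‖ * ‖y - y₀‖ ≤ ε * ‖z‖ ^ 2 + ‖y - y₀‖ ^ 2 / (4 * ε) := by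
    have : ε * ‖z‖ ^ 2 + ‖y - y₀‖ ^ 2 / (4 * ε) - ‖z‖ * ‖y - y₀‖
        = (2 * ε * ‖z‖ - ‖y - y₀‖) ^ 2 / (4 * ε) := by field_simp; ring
    have : 0 ≤ (2 * ε * ‖z‖ - ‖y - y₀‖) ^ 2 / (4 * ε) := by positivity
    linarith
  linarith

/-- The regularization `(g + ε|·|²)* + ε|·|²` of `g*`. It is finite with finite conjugate, lies
below `g* + ε|·|²`, and its conjugate lies below `g + ε|·|²`. -/
def regularize (ε : ℝ) (g : Rn n → EReal) : Rn n → EReal := addSq ε (conj (addSq ε g))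

lemma regularize_mem_classV {g : Rn n → EReal} {z₀ y₀ : Rn n}
    (hz₀ : g z₀ ≠ ⊤) (hy₀ : conj g y₀ ≠ ⊤) {ε : ℝ} (hε : 0 < ε) :
    regularize ε g ∈ classV n := by
  have hfin : ∀ x, regularize ε g x ≠ ⊥ ∧ regularize ε g x ≠ ⊤ := fun x =>
    ⟨addSq_ne_bot ε (conj_ne_bot (addSq_ne_top ε hz₀) x),
      addSq_ne_top ε (conj_addSq_ne_top hy₀ hε x)⟩
  refine ⟨(isConvexFn_conj _).addSq hε.le, hfin, fun y => ⟨conj_ne_bot (hfin 0).2 y, ?_⟩⟩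
  refine conj_addSq_ne_top (y₀ := z₀) ?_ hε y
  exact ne_top_of_le_ne_top (addSq_ne_top ε hz₀) (conj_conj_le _ _)

lemma IsEven.regularize {g : Rn n → EReal} (hg : IsEven g) (ε : ℝ) : IsEven (regularize ε g) :=
  ((hg.addSq ε).conj).addSq ε

lemma conj_addSq_le_regularize {ε : ℝ} (hε : 0 ≤ ε) (g : Rn n → EReal) (x : Rn n) :
    conj (addSq ε g) x ≤ regularize ε g x :=
  le_add_of_nonneg_right (EReal.coe_nonneg.2 (by positivity))

lemma conj_addSq_conj_le_conj_regularize {ε : ℝ} (hε : 0 ≤ ε) (g : Rn n → EReal) (y : Rn n) :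
    conj (addSq ε (conj g)) y ≤ conj (regularize ε g) y := by
  refine conj_antitone (fun x => ?_) y
  refine add_le_add (conj_antitone (fun z => ?_) x) le_rfl
  exact le_add_of_nonneg_right (EReal.coe_nonneg.2 (by positivity))

/-! ### Convex functions of linear growth -/

lemma integrable_exp_neg_mul_norm {a : ℝ} (ha : 0 < a) :
    Integrable (fun x : Rn n => Real.exp (-(a * ‖x‖))) := by
  have hm : (Module.finrank ℝ (Rn n) : ℝ) < ((n + 1 : ℕ) : ℝ) := by simp
  refine ((integrable_one_add_norm (μ := volume) hm).const_mul
    ((n + 1).factorial * Real.exp a * (a ^ (n + 1))⁻¹)).mono' (by fun_prop) (ae_of_all _ fun x => ?_)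
  have h1 : 0 < 1 + ‖x‖ := by positivity
  have h2 := Real.pow_div_factorial_le_exp (a * (1 + ‖x‖)) (by positivity) (n + 1)
  rw [Real.norm_of_nonneg (Real.exp_pos _).le, Real.rpow_neg h1.le, Real.rpow_natCast,
    Real.exp_neg]
  rw [div_le_iff₀ (by positivity), mul_pow, mul_add, mul_one, Real.exp_add] at h2
  rw [← one_div, div_le_iff₀ (Real.exp_pos _)]
  have h3 : 0 < a ^ (n + 1) * (1 + ‖x‖) ^ (n + 1) := by positivity
  calc 1 ≤ (Real.exp a * Real.exp (a * ‖x‖) * (n + 1).factorial) /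
        (a ^ (n + 1) * (1 + ‖x‖) ^ (n + 1)) := (one_le_div h3).2 h2
    _ = _ := by field_simp

lemma exists_norm_sub_le {φ : Rn n → ℝ} (h : ∀ y, ∃ M : ℝ, ∀ x, ⟪x, y⟫_ℝ - φ x ≤ M) :
    ∃ C : ℝ, ∀ x, ‖x‖ - C ≤ φ x := by
  choose M hM using h
  set b : Fin n → Rn n := fun i => EuclideanSpace.single i ((n : ℝ) + 1) with hb
  have hnn : ∀ i, ∀ x : Rn n, ⟪x, b i⟫_ℝ = (n + 1) * x i := by
    intro i x
    simp [hb, EuclideanSpace.inner_single_right]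
  set C : ℝ := |M 0| + ∑ i, (|M (b i)| + |M (-(b i))|) with hC
  refine ⟨C, fun x => ?_⟩
  have h0 : -φ x ≤ C := by
    have h1 := hM 0 x
    have h2 : 0 ≤ ∑ i, (|M (b i)| + |M (-(b i))|) := Finset.sum_nonneg fun i _ => by positivity
    have h3 := le_abs_self (M 0)
    simp only [inner_zero_right] at h1
    linarith
  have hi : ∀ i, (n + 1) * |x i| ≤ φ x + C := by
    intro i
    have h1 := hM (b i) x
    have h2 := hM (-(b i)) x
    rw [inner_neg_right] at h2
    rw [hnn] at h1 h2
    have h3 : |M (b i)| + |M (-(b i))| ≤ ∑ i, (|M (b i)| + |M (-(b i))|) :=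
      Finset.single_le_sum (f := fun i => |M (b i)| + |M (-(b i))|)
        (fun i _ => by positivity) (Finset.mem_univ i)
    have h4 := abs_nonneg (M 0)
    have h5 := le_abs_self (M (b i))
    have h6 := le_abs_self (M (-(b i)))
    have h7 := abs_nonneg (M (b i))
    have h8 := abs_nonneg (M (-(b i)))
    rcases abs_cases (x i) with ⟨h, -⟩ | ⟨h, -⟩ <;> rw [h] <;> linarith
  have hsum : ‖x‖ ≤ ∑ i, |x i| := by
    rw [EuclideanSpace.norm_eq, Real.sqrt_le_left (Finset.sum_nonneg fun i _ => abs_nonneg _)]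
    exact Finset.sum_sq_le_sq_sum_of_nonneg fun i _ => abs_nonneg _
  have hle : ∑ i, (n + 1) * |x i| ≤ ∑ _i : Fin n, (φ x + C) := Finset.sum_le_sum fun i _ => hi i
  rw [← Finset.mul_sum, Finset.sum_const, Finset.card_univ, Fintype.card_fin, nsmul_eq_mul] at hle
  have h9 : (0 : ℝ) < n + 1 := by positivity
  have h10 : (n : ℝ) * (φ x + C) ≤ (n + 1) * (φ x + C) := by nlinarith
  have := le_of_mul_le_mul_left (hle.trans h10) h9
  linarith

section Growth

variable {φ : Rn n → ℝ} {C : ℝ}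

lemma continuous_of_convexOn (hφ : ConvexOn ℝ univ φ) : Continuous φ :=
  hφ.locallyLipschitz.continuous

lemma integrable_exp_neg (hφ : ConvexOn ℝ univ φ) (hC : ∀ x, ‖x‖ - C ≤ φ x) :
    Integrable (fun x => Real.exp (-φ x)) := by
  have hc := continuous_of_convexOn hφ
  refine ((integrable_exp_neg_mul_norm one_pos).const_mul (Real.exp C)).mono'
    (by fun_prop) (ae_of_all _ fun x => ?_)
  rw [Real.norm_of_nonneg (Real.exp_pos _).le, ← Real.exp_add, Real.exp_le_exp]
  linarith [hC x]

lemma integrable_mul_exp_neg (hφ : ConvexOn ℝ univ φ) (hC : ∀ x, ‖x‖ - C ≤ φ x) :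
    Integrable (fun x => φ x * Real.exp (-φ x)) := by
  have hc := continuous_of_convexOn hφ
  refine ((integrable_exp_neg_mul_norm (n := n) (show (0 : ℝ) < 1 / 2 by norm_num)).const_mul
    (2 * Real.exp |C| * Real.exp (C / 2))).mono' (by fun_prop) (ae_of_all _ fun x => ?_)
  rw [norm_mul, Real.norm_of_nonneg (Real.exp_pos _).le, Real.norm_eq_abs]
  have h1 : |φ x| / 2 ≤ Real.exp (|C| + φ x / 2) := by
    have h2 := Real.add_one_le_exp (|C| + φ x / 2)
    have h3 := hC x
    have h4 := norm_nonneg x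
    have h5 := le_abs_self C
    have h6 := abs_nonneg C
    rcases abs_cases (φ x) with ⟨h, -⟩ | ⟨h, -⟩ <;> rw [h] <;> linarith
  calc |φ x| * Real.exp (-φ x) ≤ 2 * Real.exp (|C| + φ x / 2) * Real.exp (-φ x) := by
        gcongr; linarith
    _ = 2 * Real.exp |C| * Real.exp (-(φ x / 2)) := by
        rw [mul_assoc, mul_assoc, ← Real.exp_add, ← Real.exp_add]; ring_nf
    _ ≤ 2 * Real.exp |C| * Real.exp (C / 2 + -(1 / 2 * ‖x‖)) := by
        gcongr; linarith [hC x]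
    _ = _ := by rw [Real.exp_add, ← mul_assoc]

/-- Rademacher's theorem for convex functions. -/
lemma ae_differentiableAt_of_convexOn (hφ : ConvexOn ℝ univ φ) :
    ∀ᵐ x, DifferentiableAt ℝ φ x := by
  refine measure_null_of_locally_null _ fun x _ => ?_
  obtain ⟨K, t, ht, hK⟩ := hφ.locallyLipschitz x
  have hKi : LipschitzOnWith K φ (interior t) := hK.mono interior_subset
  refine ⟨_, inter_mem_nhdsWithin _ (interior_mem_nhds.2 ht), ?_⟩
  refine measure_mono_null ?_ (ae_iff.1 (hKi.ae_differentiableWithinAt_of_mem (μ := volume)))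
  rintro y ⟨hy, hyt⟩ h
  exact hy ((h hyt).differentiableAt (isOpen_interior.mem_nhds hyt))

lemma add_inner_gradient_le (hφ : ConvexOn ℝ univ φ) {x : Rn n} (hx : DifferentiableAt ℝ φ x)
    (y : Rn n) : φ x + ⟪gradient φ x, y - x⟫_ℝ ≤ φ y := by
  have h1 : HasLineDerivAt ℝ φ (fderiv ℝ φ x (y - x)) x (y - x) :=
    hx.hasFDerivAt.hasLineDerivAt _
  rw [← inner_gradient_left] at h1
  have h2 := h1.tendsto_slope_zero_right
  suffices ⟪gradient φ x, y - x⟫_ℝ ≤ φ y - φ x by linarith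
  refine le_of_tendsto h2 ?_
  filter_upwards [Ioo_mem_nhdsGT (show (0 : ℝ) < 1 by norm_num)] with t ht
  have h3 := hφ.2 (mem_univ x) (mem_univ y) (sub_nonneg.2 ht.2.le) ht.1.le (by ring)
  have h4 : x + t • (y - x) = (1 - t) • x + t • y := by module
  rw [h4, smul_eq_mul, inv_mul_le_iff₀ ht.1]
  simp only [smul_eq_mul] at h3
  linarith

lemma measurable_gradient (φ : Rn n → ℝ) : Measurable (gradient φ) :=
  (InnerProductSpace.toDual ℝ (Rn n)).symm.continuous.measurable.comp (measurable_fderiv ℝ φ)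

/-- The inequality `∫ ⟨∇φ, x⟩ e^{-φ} ≤ n ∫ e^{-φ}`, which is all of the integration by parts that
is needed. It is the derivative at `t = 0` of the dilation identity
`∫ e^{-φ((1 + t) x)} dx = (1 + t)^{-n} ∫ e^{-φ}`; Fatou's lemma replaces a domination of the
difference quotients, which are nonnegative once `e^{-φ(x)}` is multiplied by `e^{tK}`, where
`φ ≥ φ 0 - K`. -/
lemma integrable_inner_gradient_mul_exp_neg (hφ : ConvexOn ℝ univ φ)
    (hC : ∀ x, ‖x‖ - C ≤ φ x) :
    Integrable (fun x => ⟪gradient φ x, x⟫_ℝ * Real.exp (-φ x)) ∧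
      ∫ x, ⟪gradient φ x, x⟫_ℝ * Real.exp (-φ x) ≤ n * ∫ x, Real.exp (-φ x) := by
  have hc := continuous_of_convexOn hφ
  have hint := integrable_exp_neg hφ hC
  set Z : ℝ := ∫ x, Real.exp (-φ x) with hZ
  set K : ℝ := |φ 0 + C| with hK
  have hK0 : ∀ x, φ 0 - K ≤ φ x := fun x => by
    linarith [hC x, norm_nonneg x, le_abs_self (φ 0 + C)]
  set G : ℝ → Rn n → ℝ := fun t x =>
    Real.exp (t * K) * Real.exp (-φ x) - Real.exp (-φ ((1 + t) • x)) with hG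
  have hG0 : ∀ x, G 0 x = 0 := fun x => by simp [hG]
  set D : ℝ → Rn n → ℝ := fun t x => t⁻¹ * G t x with hD
  have hDcont : ∀ t, Continuous (D t) := fun t => by simp only [hD, hG]; fun_prop
  have hint' : ∀ t : ℝ, 0 < t → Integrable (fun x : Rn n => Real.exp (-φ ((1 + t) • x))) :=
    fun t ht => (integrable_comp_smul_iff volume (fun x => Real.exp (-φ x))
      (by positivity : (1 + t) ≠ 0)).2 hint
  have hDint : ∀ t : ℝ, 0 < t → Integrable (D t) := fun t ht =>
    ((hint.const_mul _).sub (hint' t ht)).const_mul _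
  have hDnonneg : ∀ t : ℝ, 0 < t → ∀ x, 0 ≤ D t x := by
    intro t ht x
    refine mul_nonneg (inv_nonneg.2 ht.le) (sub_nonneg.2 ?_)
    rw [← Real.exp_add, Real.exp_le_exp]
    -- convexity along the ray, in the form `x = t/(1+t) • 0 + 1/(1+t) • (1+t) x`
    have h1 := hφ.2 (mem_univ (0 : Rn n)) (mem_univ ((1 + t) • x)) 
      (by positivity : 0 ≤ t / (1 + t)) (by positivity : 0 ≤ 1 / (1 + t)) (by field_simp; ring)
    rw [smul_zero, zero_add, smul_smul, one_div_mul_cancel (by positivity), one_smul] at h1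
    have h2 : (1 + t) * φ x ≤ t * φ 0 + φ ((1 + t) • x) := by
      have h3 := mul_le_mul_of_nonneg_left h1 (by positivity : 0 ≤ 1 + t)
      simp only [smul_eq_mul] at h3
      have h4 : (1 + t) * (t / (1 + t) * φ 0 + 1 / (1 + t) * φ ((1 + t) • x)) =
        t * φ 0 + φ ((1 + t) • x) := by field_simp
      linarith
    nlinarith [hK0 x]
  have hDval : ∀ t : ℝ, 0 < t →
      ∫ x, D t x = t⁻¹ * ((Real.exp (t * K) - ((1 + t) ^ n)⁻¹) * Z) := by
    intro t ht
    simp only [hD, hG]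
    rw [integral_const_mul, integral_sub (hint.const_mul _) (hint' t ht), integral_const_mul,
      Measure.integral_comp_smul volume (fun x => Real.exp (-φ x)), finrank_euclideanSpace_fin,
      abs_of_nonneg (by positivity), smul_eq_mul]
    ring
  -- limits of the difference quotients and of their integrals
  have hlim : ∀ x, DifferentiableAt ℝ φ x → Tendsto (fun t => D t x) (𝓝[>] 0)
      (𝓝 ((K + ⟪gradient φ x, x⟫_ℝ) * Real.exp (-φ x))) := by
    intro x hx
    have h1 : HasDerivAt (fun t : ℝ => φ ((1 + t) • x)) ⟪gradient φ x, x⟫_ℝ 0 := by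
      have h2 : HasLineDerivAt ℝ φ (fderiv ℝ φ x x) x x := hx.hasFDerivAt.hasLineDerivAt _
      rw [← inner_gradient_left] at h2
      simpa [HasLineDerivAt, add_smul] using h2
    have h3 : HasDerivAt (fun t : ℝ => G t x)
        ((K + ⟪gradient φ x, x⟫_ℝ) * Real.exp (-φ x)) 0 := by
      have h4 := (((hasDerivAt_id (0 : ℝ)).mul_const K).exp.mul_const (Real.exp (-φ x))).sub
        h1.neg.exp
      refine HasDerivAt.congr_deriv h4 ?_
      simp
      ring
    have h5 := h3.tendsto_slope_zero_right
    simpa [hD, hG0] using h5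
  have hlimint : Tendsto (fun t => ∫ x, D t x) (𝓝[>] 0) (𝓝 ((K + n) * Z)) := by
    have h1 : HasDerivAt (fun t : ℝ => (Real.exp (t * K) - ((1 + t) ^ n)⁻¹) * Z)
        ((K + n) * Z) 0 := by
      have h2 := ((((hasDerivAt_id (0 : ℝ)).mul_const K).exp.sub
        ((((hasDerivAt_id (0 : ℝ)).const_add 1).pow n).inv (by simp))).mul_const Z)
      refine HasDerivAt.congr_deriv h2 ?_
      simp
    have h3 := h1.tendsto_slope_zero_right
    refine h3.congr' ?_
    filter_upwards [self_mem_nhdsWithin] with t ht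
    rw [hDval t ht]
    simp
  have hae := ae_differentiableAt_of_convexOn hφ
  set g : Rn n → ℝ := fun x => (K + ⟪gradient φ x, x⟫_ℝ) * Real.exp (-φ x) with hg
  have hgmeas : Measurable g := by
    have := measurable_gradient φ
    exact ((this.inner measurable_id).const_add K).mul (by fun_prop)
  have hgnonneg : 0 ≤ᵐ[volume] g := by
    filter_upwards [hae] with x hx
    have h1 := add_inner_gradient_le hφ hx 0
    rw [zero_sub, inner_neg_right] at h1
    exact mul_nonneg (by linarith [hK0 x]) (Real.exp_pos _).le
  have hfatou : ∫⁻ x, ENNReal.ofReal (g x) ≤ ENNReal.ofReal ((K + n) * Z) := by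
    calc ∫⁻ x, ENNReal.ofReal (g x)
        = ∫⁻ x, liminf (fun t => ENNReal.ofReal (D t x)) (𝓝[>] 0) := by
          refine lintegral_congr_ae ?_
          filter_upwards [hae] with x hx
          exact ((ENNReal.tendsto_ofReal (hlim x hx)).liminf_eq).symm
      _ ≤ liminf (fun t => ∫⁻ x, ENNReal.ofReal (D t x)) (𝓝[>] 0) :=
          lintegral_liminf_le fun t => (hDcont t).measurable.ennreal_ofReal
      _ = ENNReal.ofReal ((K + n) * Z) := by
          refine Tendsto.liminf_eq ((ENNReal.tendsto_ofReal hlimint).congr' ?_)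
          filter_upwards [self_mem_nhdsWithin] with t ht
          exact ofReal_integral_eq_lintegral_ofReal (hDint t ht) (ae_of_all _ (hDnonneg t ht))
  have hgint : Integrable g :=
    (lintegral_ofReal_ne_top_iff_integrable hgmeas.aestronglyMeasurable hgnonneg).1
      (ne_top_of_le_ne_top ENNReal.ofReal_ne_top hfatou)
  have hgle : ∫ x, g x ≤ (K + n) * Z := by
    rw [← ofReal_integral_eq_lintegral_ofReal hgint hgnonneg] at hfatou
    refine (ENNReal.ofReal_le_ofReal_iff ?_).1 hfatou
    have : 0 ≤ Z := integral_nonneg fun x => (Real.exp_pos _).le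
    positivity
  have hsub : (fun x => ⟪gradient φ x, x⟫_ℝ * Real.exp (-φ x)) =
      fun x => g x - K * Real.exp (-φ x) := by
    funext x
    simp only [hg]
    ring
  rw [hsub]
  refine ⟨hgint.sub (hint.const_mul K), ?_⟩
  rw [integral_sub hgint (hint.const_mul K), integral_const_mul]
  linarith

end Growth

/-! ### Entropy, moment measures and the bound for one potential -/

lemma eintegral_eq_integral {f : Rn n → EReal} {g : Rn n → ℝ} {μ : Measure (Rn n)}
    (hfg : f =ᵐ[μ] fun x => (g x : EReal)) (hg : Integrable g μ) :
    eintegral f μ = ((∫ x, g x ∂μ : ℝ) : EReal) := by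
  have h1 : ∫⁻ x, (f x).toENNReal ∂μ = ∫⁻ x, ENNReal.ofReal (g x) ∂μ := by
    refine lintegral_congr_ae ?_
    filter_upwards [hfg] with x hx
    rw [hx, EReal.toENNReal_of_ne_top (EReal.coe_ne_top _), EReal.toReal_coe]
  have h2 : ∫⁻ x, (-f x).toENNReal ∂μ = ∫⁻ x, ENNReal.ofReal (-g x) ∂μ := by
    refine lintegral_congr_ae ?_
    filter_upwards [hfg] with x hx
    rw [hx, ← EReal.coe_neg, EReal.toENNReal_of_ne_top (EReal.coe_ne_top _), EReal.toReal_coe]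
  rw [eintegral, h1, h2, integral_eq_lintegral_pos_part_sub_lintegral_neg_part hg, EReal.coe_sub,
    EReal.coe_ennreal_toReal hg.lintegral_lt_top.ne,
    EReal.coe_ennreal_toReal (Integrable.lintegral_lt_top (f := fun x => -g x) hg.neg).ne]

lemma eintegral_map {f : Rn n → EReal} {T : Rn n → Rn n} {μ : Measure (Rn n)}
    (hf : Measurable f) (hT : Measurable T) :
    eintegral f (μ.map T) = eintegral (f ∘ T) μ := by
  rw [eintegral, eintegral, lintegral_map hf.ereal_toENNReal hT,
    lintegral_map (f := fun x => (-f x).toENNReal) hf.neg.ereal_toENNReal hT]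
  rfl

section Potential

variable {φ : Rn n → ℝ} {C : ℝ}

lemma integral_exp_neg_pos (hφ : ConvexOn ℝ univ φ) (hC : ∀ x, ‖x‖ - C ≤ φ x) :
    0 < ∫ x, Real.exp (-φ x) :=
  integral_exp_pos (integrable_exp_neg hφ hC)

lemma expInt_coe (hφ : ConvexOn ℝ univ φ) (hC : ∀ x, ‖x‖ - C ≤ φ x) :
    expInt (fun x => (φ x : EReal)) = ENNReal.ofReal (∫ x, Real.exp (-φ x)) := by
  rw [ofReal_integral_eq_lintegral_ofReal (integrable_exp_neg hφ hC)
    (ae_of_all _ fun x => (Real.exp_pos _).le)]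
  simp only [expInt, ← EReal.coe_neg, EReal.exp_coe]

lemma gibbs_coe (hφ : ConvexOn ℝ univ φ) (hC : ∀ x, ‖x‖ - C ≤ φ x) :
    gibbs (fun x => (φ x : EReal)) = (volume : Measure (Rn n)).withDensity
      (fun x => ENNReal.ofReal ((∫ x, Real.exp (-φ x))⁻¹ * Real.exp (-φ x))) := by
  have hpos := integral_exp_neg_pos hφ hC
  have hc := continuous_of_convexOn hφ
  rw [gibbs, expInt_coe hφ hC, ← withDensity_smul _ (by fun_prop)]
  congr 1
  funext x
  rw [Pi.smul_apply, smul_eq_mul, ← EReal.coe_neg, EReal.exp_coe,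
    ENNReal.ofReal_mul (inv_nonneg.2 hpos.le), ENNReal.ofReal_inv_of_pos hpos]

lemma integrable_gibbs (hφ : ConvexOn ℝ univ φ) (hC : ∀ x, ‖x‖ - C ≤ φ x) {g : Rn n → ℝ}
    (hg : Integrable (fun x => g x * Real.exp (-φ x))) :
    Integrable g (gibbs (fun x => (φ x : EReal))) := by
  have hpos := integral_exp_neg_pos hφ hC
  have hc := continuous_of_convexOn hφ
  rw [gibbs_coe hφ hC, integrable_withDensity_iff_integrable_smul' (by fun_prop)
    (ae_of_all _ fun x => ENNReal.ofReal_lt_top)]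
  refine (hg.const_mul (∫ x, Real.exp (-φ x))⁻¹).congr (ae_of_all _ fun x => ?_)
  simp only [smul_eq_mul]
  rw [ENNReal.toReal_ofReal (by positivity)]
  ring

lemma integral_gibbs (hφ : ConvexOn ℝ univ φ) (hC : ∀ x, ‖x‖ - C ≤ φ x) (g : Rn n → ℝ) :
    ∫ x, g x ∂(gibbs (fun x => (φ x : EReal))) =
      (∫ x, Real.exp (-φ x))⁻¹ * ∫ x, g x * Real.exp (-φ x) := by
  have hpos := integral_exp_neg_pos hφ hC
  have hc := continuous_of_convexOn hφ
  rw [gibbs_coe hφ hC, integral_withDensity_eq_integral_toReal_smul (by fun_prop)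
    (ae_of_all _ fun x => ENNReal.ofReal_lt_top), ← integral_const_mul]
  refine integral_congr_ae (ae_of_all _ fun x => ?_)
  simp only [smul_eq_mul]
  rw [ENNReal.toReal_ofReal (by positivity)]
  ring

lemma entropy_gibbs (hφ : ConvexOn ℝ univ φ) (hC : ∀ x, ‖x‖ - C ≤ φ x) :
    entropy (gibbs (fun x => (φ x : EReal))) = ((-Real.log (∫ x, Real.exp (-φ x)) -
      ∫ x, φ x ∂(gibbs (fun x => (φ x : EReal))) : ℝ) : EReal) := by
  have hpos := integral_exp_neg_pos hφ hC
  have hc := continuous_of_convexOn hφ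
  have hint1 := integrable_gibbs hφ hC (integrable_mul_exp_neg hφ hC)
  have hint2 : Integrable (fun _ : Rn n => -Real.log (∫ x, Real.exp (-φ x)))
      (gibbs (fun x => (φ x : EReal))) :=
    integrable_gibbs hφ hC ((integrable_exp_neg hφ hC).const_mul _)
  rw [entropy, eintegral_eq_integral
    (g := fun x => -Real.log (∫ x, Real.exp (-φ x)) - φ x) ?_ (hint2.sub hint1)]
  · rw [integral_sub hint2 hint1, integral_gibbs hφ hC (fun _ => -Real.log _), integral_const_mul]
    congr 2
    field_simp
  · have hac : gibbs (fun x => (φ x : EReal)) ≪ volume := by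
      rw [gibbs_coe hφ hC]
      exact withDensity_absolutelyContinuous _ _
    refine hac.ae_le ?_
    rw [gibbs_coe hφ hC]
    filter_upwards [Measure.rnDeriv_withDensity volume (f := fun x : Rn n =>
      ENNReal.ofReal ((∫ x, Real.exp (-φ x))⁻¹ * Real.exp (-φ x))) (by fun_prop)] with x hx
    rw [hx, ENNReal.log_ofReal_of_pos (by positivity), Real.log_mul (by positivity) (by positivity),
      Real.log_inv, Real.log_exp, sub_eq_add_neg]

lemma conj_gradient (hφ : ConvexOn ℝ univ φ) {x : Rn n} (hx : DifferentiableAt ℝ φ x) :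
    conj (fun x => (φ x : EReal)) (gradient φ x) =
      ((⟪gradient φ x, x⟫_ℝ - φ x : ℝ) : EReal) := by
  refine le_antisymm (conj_le_coe_iff.2 fun z t hz => ?_) ?_
  · have h1 := add_inner_gradient_le hφ hx z
    have h2 := EReal.coe_le_coe_iff.1 hz
    rw [inner_sub_right] at h1
    rw [real_inner_comm]
    linarith
  · rw [real_inner_comm]
    exact le_conj le_rfl

lemma eintegral_conj_momentMeasure_le (hφ : ConvexOn ℝ univ φ) (hC : ∀ x, ‖x‖ - C ≤ φ x) :
    eintegral (conj fun x => (φ x : EReal)) (momentMeasure fun x => (φ x : EReal)) ≤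
      ((n - ∫ x, φ x ∂(gibbs (fun x => (φ x : EReal))) : ℝ) : EReal) := by
  have hpos := integral_exp_neg_pos hφ hC
  obtain ⟨hint, hle⟩ := integrable_inner_gradient_mul_exp_neg hφ hC
  have hint1 := integrable_gibbs hφ hC hint
  have hint2 := integrable_gibbs hφ hC (integrable_mul_exp_neg hφ hC)
  have hae : ((conj fun x => (φ x : EReal)) ∘ gradient φ) =ᵐ[gibbs (fun x => (φ x : EReal))]
      fun x => ((⟪gradient φ x, x⟫_ℝ - φ x : ℝ) : EReal) := by
    have hac : gibbs (fun x => (φ x : EReal)) ≪ volume := by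
      rw [gibbs_coe hφ hC]
      exact withDensity_absolutelyContinuous _ _
    refine hac.ae_le ?_
    filter_upwards [ae_differentiableAt_of_convexOn hφ] with x hx
    exact conj_gradient hφ hx
  rw [momentMeasure]
  simp only [EReal.toReal_coe]
  rw [eintegral_map (measurable_conj _) (measurable_gradient φ),
    eintegral_eq_integral hae (hint1.sub hint2), integral_sub hint1 hint2, EReal.coe_le_coe_iff,
    integral_gibbs hφ hC (fun x => ⟪gradient φ x, x⟫_ℝ)]
  refine sub_le_sub_right ?_ _
  rwa [inv_mul_le_iff₀ hpos, mul_comm]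

end Potential

lemma exists_coe_of_mem_classV {V : Rn n → EReal} (hV : V ∈ classV n) :
    ∃ (φ : Rn n → ℝ) (C : ℝ), V = (fun x => (φ x : EReal)) ∧ ConvexOn ℝ univ φ ∧
      ∀ x, ‖x‖ - C ≤ φ x := by
  obtain ⟨hconv, hfin, hconj⟩ := hV
  have hφ : ∀ x, V x = ((V x).toReal : EReal) := fun x =>
    (EReal.coe_toReal (hfin x).2 (hfin x).1).symm
  obtain ⟨C, hC⟩ := exists_norm_sub_le (φ := fun x => (V x).toReal) fun y => by
    obtain ⟨M, hM⟩ := exists_le_coe (hconj y).2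
    exact ⟨M, fun x => conj_le_coe_iff.1 hM x _ (hφ x).le⟩
  refine ⟨fun x => (V x).toReal, C, funext hφ, ⟨convex_univ, fun x _ y _ a b ha hb hab => ?_⟩, hC⟩
  have h1 := hconv (x := (x, (V x).toReal)) (hφ x).le (y := (y, (V y).toReal)) (hφ y).le ha hb hab
  have h2 : V (a • x + b • y) ≤ ((a * (V x).toReal + b * (V y).toReal : ℝ) : EReal) := h1
  rw [hφ] at h2
  exact EReal.coe_le_coe_iff.1 h2

lemma conj_mem_classV {V : Rn n → EReal} (hV : V ∈ classV n) : conj V ∈ classV n :=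
  ⟨isConvexFn_conj V, hV.2.2, fun x => ⟨conj_ne_bot (hV.2.2 0).2 x,
    ne_top_of_le_ne_top (hV.2.1 x).2 (conj_conj_le V x)⟩⟩

/-- The Entropy-Transport inequality for `V` implies the inverse Santaló inequality for `V`:
`V*` is an admissible potential in `𝒯(ν, ν*)`. -/
theorem le_expInt_mul_expInt_conj {c : ℝ} (hc : 0 < c) {V : Rn n → EReal} (hV : V ∈ classV n)
    (h : EntropyTransportIneq c V) :
    ENNReal.ofReal (c ^ n) ≤ expInt V * expInt (conj V) := by
  have hF : conj V ∈ classF n :=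
    ⟨fun y => (hV.2.2 y).1, isConvexFn_conj V, lowerSemicontinuous_conj V, 0, (hV.2.2 0).2⟩
  have hT : maxCorr (momentMeasure V) (momentMeasure (conj V)) ≤
      eintegral (conj V) (momentMeasure V) + eintegral (conj (conj V)) (momentMeasure (conj V)) :=
    iInf₂_le (conj V) hF
  rw [EntropyTransportIneq] at h
  replace h := h.trans (add_le_add le_rfl hT)
  obtain ⟨ψ, C', hψV, hψ, hC'⟩ := exists_coe_of_mem_classV (conj_mem_classV hV)
  rw [hψV] at h ⊢
  replace h := h.trans (add_le_add le_rfl (add_le_add le_rfl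
    (eintegral_conj_momentMeasure_le hψ hC')))
  rw [← hψV] at h
  obtain ⟨φ, C, rfl, hφ, hC⟩ := exists_coe_of_mem_classV hV
  replace h := h.trans (add_le_add le_rfl (add_le_add (eintegral_conj_momentMeasure_le hφ hC)
    le_rfl))
  rw [hψV, entropy_gibbs hφ hC, entropy_gibbs hψ hC'] at h
  simp only [← EReal.coe_add, EReal.coe_le_coe_iff] at h
  have hp := integral_exp_neg_pos hφ hC
  have hq := integral_exp_neg_pos hψ hC'
  rw [expInt_coe hφ hC, expInt_coe hψ hC', ← ENNReal.ofReal_mul hp.le]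
  refine ENNReal.ofReal_le_ofReal ((Real.log_le_log_iff (by positivity) (by positivity)).1 ?_)
  rw [Real.log_pow, Real.log_mul hp.ne' hq.ne']
  rw [Real.log_mul hc.ne' (Real.exp_pos _).ne', Real.log_exp] at h
  linarith

/-! ### Interior of the domain and the limit of the regularizations -/

lemma expInt_anti {f g : Rn n → EReal} (h : ∀ x, f x ≤ g x) : expInt g ≤ expInt f :=
  lintegral_mono fun x => EReal.exp_monotone (EReal.neg_le_neg_iff.2 (h x))

lemma exists_ne_top_of_expInt_pos {f : Rn n → EReal} (h : 0 < expInt f) : ∃ x, f x ≠ ⊤ := by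
  by_contra! hf
  simp [expInt, hf] at h

/-- A nonzero function that increases along translations by `u ≠ 0` has infinite integral: its
integrals over the slabs `{j ≤ ⟨y, u⟩ / |u|² < j + 1}` increase with `j`. -/
lemma lintegral_eq_top_of_le_translate {F : Rn n → ℝ≥0∞} {u : Rn n} (hu : u ≠ 0)
    (hF : ∀ y, F y ≤ F (y + u)) (hpos : 0 < ∫⁻ y, F y) : ∫⁻ y, F y = ∞ := by
  have hu2 : ‖u‖ ^ 2 ≠ 0 := by simpa using hu
  set k : Rn n → ℤ := fun y => ⌊⟪y, u⟫_ℝ / ‖u‖ ^ 2⌋ with hk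
  have hkmeas : Measurable k :=
    Int.measurable_floor.comp ((measurable_id.inner measurable_const).div_const _)
  have hkadd : ∀ y, k (y + u) = k y + 1 := by
    intro y
    simp only [hk]
    rw [inner_add_left, real_inner_self_eq_norm_sq, add_div, div_self hu2, Int.floor_add_one]
  set S : ℤ → Set (Rn n) := fun j => k ⁻¹' {j} with hS
  have hSmeas : ∀ j, MeasurableSet (S j) := fun j => hkmeas (measurableSet_singleton j)
  set I : ℤ → ℝ≥0∞ := fun j => ∫⁻ y in S j, F y with hI
  have hmono : Monotone I := monotone_int_of_le_succ fun j => by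
    simp only [hI]
    rw [← lintegral_indicator (hSmeas _), ← lintegral_indicator (hSmeas _),
      ← lintegral_add_right_eq_self (fun y => (S (j + 1)).indicator F y) u]
    refine lintegral_mono fun y => ?_
    by_cases hy : y ∈ S j
    · have hy' : y + u ∈ S (j + 1) := by
        have hy0 : k y = j := hy
        change k (y + u) = j + 1
        rw [hkadd, hy0]
      rw [indicator_of_mem hy, indicator_of_mem hy']
      exact hF y
    · rw [indicator_of_notMem hy]
      exact zero_le
  have hsum : ∫⁻ y, F y = ∑' j, I j := by
    have hunion : ⋃ j, S j = univ := by
      ext y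
      simp [hS]
    rw [← setLIntegral_univ, ← hunion, lintegral_iUnion hSmeas fun i j hij =>
      Disjoint.preimage k (disjoint_singleton.2 hij)]
  rw [hsum] at hpos ⊢
  obtain ⟨j, hj⟩ : ∃ j, I j ≠ 0 := by
    by_contra! h
    simp [h] at hpos
  rw [eq_top_iff]
  calc ∞ = ∑' _ : ℕ, I j := (ENNReal.tsum_const_eq_top_of_ne_zero hj).symm
    _ ≤ ∑' i : ℕ, I (j + i) := ENNReal.tsum_le_tsum fun i => hmono (by omega)
    _ ≤ ∑' i, I i := ENNReal.tsum_comp_le_tsum_of_injective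
        (f := fun i : ℕ => j + (i : ℤ)) (fun a b hab => by simpa using hab) I

lemma IsConvexFn.convex_dom {h : Rn n → EReal} (hconv : IsConvexFn h) :
    Convex ℝ {x | h x ≠ ⊤} := by
  intro x hx y hy a b ha hb hab
  obtain ⟨s, hs⟩ := exists_le_coe hx
  obtain ⟨t, ht⟩ := exists_le_coe hy
  have h1 : h (a • x + b • y) ≤ ((a * s + b * t : ℝ) : EReal) :=
    hconv (x := (x, s)) hs (y := (y, t)) ht ha hb hab
  exact ne_top_of_le_ne_top (EReal.coe_ne_top _) h1

/-- If `∫ e^{-h} > 0`, the domain of `h` has nonempty interior. If `0` were outside this interior,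
a hyperplane through `0` would bound the domain, `h*` would decrease in a fixed direction, and
`∫ e^{-h*}` would be infinite. -/
lemma zero_mem_interior_dom {h : Rn n → EReal} (hconv : IsConvexFn h) (hpos : 0 < expInt h)
    (hpos' : 0 < expInt (conj h)) (hfin : expInt (conj h) ≠ ∞) :
    (0 : Rn n) ∈ interior {x | h x ≠ ⊤} := by
  have hdom := hconv.convex_dom
  have hne : (interior {x | h x ≠ ⊤}).Nonempty := by
    rw [hdom.interior_nonempty_iff_affineSpan_eq_top]
    by_contra hspan
    have h0 : volume {x : Rn n | h x ≠ ⊤} = 0 :=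
      measure_mono_null (subset_affineSpan ℝ _) (Measure.addHaar_affineSubspace volume _ hspan)
    refine hpos.ne' ?_
    rw [expInt, ← lintegral_zero (μ := (volume : Measure (Rn n)))]
    refine lintegral_congr_ae ?_
    filter_upwards [measure_eq_zero_iff_ae_notMem.1 h0] with x hx
    have hx' : h x = ⊤ := by simpa using hx
    simp [hx']
  by_contra h0
  obtain ⟨L, hL⟩ := geometric_hahn_banach_open_point hdom.interior isOpen_interior h0
  set u : Rn n := (InnerProductSpace.toDual ℝ (Rn n)).symm L with hu
  have hLu : ∀ z, ⟪z, u⟫_ℝ = L z := fun z => by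
    rw [real_inner_comm, hu, InnerProductSpace.toDual_symm_apply]
  simp only [map_zero] at hL
  have hle : ∀ z, h z ≠ ⊤ → ⟪z, u⟫_ℝ ≤ 0 := by
    intro z hz
    have hz' : z ∈ closure (interior {x | h x ≠ ⊤}) := by
      rw [hdom.closure_interior_eq_closure_of_nonempty_interior hne]
      exact subset_closure hz
    rw [hLu]
    exact closure_minimal (fun a ha => (hL a ha).le) (isClosed_Iic.preimage L.continuous) hz'
  have hu0 : u ≠ 0 := by
    rintro h1
    obtain ⟨a, ha⟩ := hne
    have h2 := hL a ha
    rw [← hLu, h1, inner_zero_right] at h2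
    exact lt_irrefl _ h2
  refine hfin (lintegral_eq_top_of_le_translate hu0 (fun y => ?_) hpos')
  refine EReal.exp_monotone (EReal.neg_le_neg_iff.2 (iSup_mono fun z => ?_))
  by_cases hz : h z = ⊤
  · simp [hz]
  · refine EReal.sub_le_sub (EReal.coe_le_coe_iff.2 ?_) le_rfl
    rw [inner_add_right]
    linarith [hle z hz]

lemma exists_le_of_zero_mem_interior_dom {h : Rn n → EReal} (hconv : IsConvexFn h)
    (hbot : ∀ x, h x ≠ ⊥) (h0 : (0 : Rn n) ∈ interior {x | h x ≠ ⊤}) :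
    ∃ a b : ℝ, 0 < a ∧ ∀ z, ‖z‖ ≤ a → h z ≤ b := by
  have hcoe : ∀ x, h x ≠ ⊤ → h x = ((h x).toReal : EReal) := fun x hx =>
    (EReal.coe_toReal hx (hbot x)).symm
  have hc : ConvexOn ℝ {x | h x ≠ ⊤} (fun x => (h x).toReal) := by
    refine ⟨hconv.convex_dom, fun x hx y hy a b ha hb hab => ?_⟩
    have h2 : h (a • x + b • y) ≤ ((a * (h x).toReal + b * (h y).toReal : ℝ) : EReal) :=
      hconv (x := (x, (h x).toReal)) (hcoe x hx).le (y := (y, (h y).toReal)) (hcoe y hy).le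
        ha hb hab
    rw [hcoe _ (hconv.convex_dom hx hy ha hb hab)] at h2
    exact EReal.coe_le_coe_iff.1 h2
  have hcont : ContinuousAt (fun x => (h x).toReal) 0 :=
    hc.continuousOn_interior.continuousAt (isOpen_interior.mem_nhds h0)
  have hev : ∀ᶠ z in 𝓝 (0 : Rn n), h z ≤ (((h 0).toReal + 1 : ℝ) : EReal) := by
    filter_upwards [hcont.eventually_lt_const (lt_add_one _), mem_interior_iff_mem_nhds.1 h0]
      with z hz hz'
    rw [hcoe z hz']
    exact EReal.coe_le_coe_iff.2 hz.le
  obtain ⟨a, ha, hsub⟩ := Metric.nhds_basis_closedBall.mem_iff.1 hev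
  exact ⟨a, _, ha, fun z hz => hsub (by simpa using hz)⟩

lemma conj_addSq_anti (h : Rn n → EReal) (x : Rn n) :
    Antitone fun ε => conj (addSq ε h) x := by
  intro ε δ hεδ
  refine conj_antitone (fun z => add_le_add le_rfl (EReal.coe_le_coe_iff.2 ?_)) x
  gcongr

lemma antitone_one_div_add_one : Antitone fun k : ℕ => 1 / ((k : ℝ) + 1) :=
  fun _ _ h => Nat.one_div_le_one_div h

lemma tendsto_conj_addSq (h : Rn n → EReal) (x : Rn n) :
    Tendsto (fun k : ℕ => conj (addSq (1 / ((k : ℝ) + 1)) h) x) atTop (𝓝 (conj h x)) := by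
  have hsup : conj h x = ⨆ k : ℕ, conj (addSq (1 / ((k : ℝ) + 1)) h) x := by
    refine le_antisymm ?_ (iSup_le fun k => conj_antitone (fun z => ?_) x)
    · rw [← EReal.le_of_forall_lt_iff_le]
      intro M hM
      rw [conj_le_coe_iff]
      intro z t hz
      have hlim : Tendsto (fun k : ℕ => ⟪z, x⟫_ℝ - (t + 1 / ((k : ℝ) + 1) * ‖z‖ ^ 2)) atTop
          (𝓝 (⟪z, x⟫_ℝ - (t + 0 * ‖z‖ ^ 2))) :=
        ((tendsto_one_div_add_atTop_nhds_zero_nat.mul_const _).const_add _).const_sub _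
      rw [zero_mul, add_zero] at hlim
      refine le_of_tendsto' hlim fun k => ?_
      refine EReal.coe_le_coe_iff.1 (le_trans ?_ ((le_iSup _ k).trans hM.le))
      exact le_conj (addSq_le_coe_iff.2 (by simpa using hz))
    · exact le_add_of_nonneg_right (EReal.coe_nonneg.2 (by positivity))
  rw [hsup]
  exact tendsto_atTop_iSup ((conj_addSq_anti h x).comp antitone_one_div_add_one)

/-- If `h` is bounded above near `0`, then `(h + |·|²)*` grows linearly, so that monotone
convergence applies to `(h + ε|·|²)* ↑ h*` as `ε ↓ 0`. -/
lemma tendsto_expInt_conj_addSq {h : Rn n → EReal} {a b : ℝ} (ha : 0 < a)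
    (hab : ∀ z, ‖z‖ ≤ a → h z ≤ b) :
    Tendsto (fun k : ℕ => expInt (conj (addSq (1 / ((k : ℝ) + 1)) h))) atTop
      (𝓝 (expInt (conj h))) := by
  refine lintegral_tendsto_of_tendsto_of_antitone
    (fun k => (EReal.measurable_exp.comp (measurable_conj _).neg).aemeasurable)
    (ae_of_all _ fun x => ?_) ?_ (ae_of_all _ fun x => ?_)
  · intro k l hkl
    exact EReal.exp_monotone (EReal.neg_le_neg_iff.2
      (conj_addSq_anti h x (antitone_one_div_add_one hkl)))
  · have hint := ((integrable_exp_neg_mul_norm (n := n) ha).const_mul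
      (Real.exp (b + a ^ 2))).lintegral_lt_top
    refine ne_top_of_le_ne_top hint.ne (lintegral_mono fun x => ?_)
    have hz : ‖(a / ‖x‖) • x‖ ≤ a := by
      rw [norm_smul, Real.norm_of_nonneg (by positivity)]
      rcases eq_or_ne ‖x‖ 0 with hx | hx
      · simpa [hx] using ha.le
      · rw [div_mul_cancel₀ _ hx]
    have hin : ⟪(a / ‖x‖) • x, x⟫_ℝ = a * ‖x‖ := by
      rw [real_inner_smul_left, real_inner_self_eq_norm_sq]
      rcases eq_or_ne x 0 with rfl | hx
      · simp
      · have := norm_ne_zero_iff.2 hx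
        field_simp
    have hle : addSq (1 / (((0 : ℕ) : ℝ) + 1)) h ((a / ‖x‖) • x) ≤ ((b + a ^ 2 : ℝ) : EReal) := by
      refine addSq_le_coe_iff.2 ((hab _ hz).trans (EReal.coe_le_coe_iff.2 ?_))
      have := pow_le_pow_left₀ (norm_nonneg _) hz 2
      simp only [Nat.cast_zero, zero_add, div_one, one_mul]
      linarith
    have h1 := le_conj (y := x) hle
    rw [hin] at h1
    rw [← Real.exp_add, ← EReal.exp_coe]
    refine EReal.exp_monotone ?_
    rw [EReal.neg_le, ← EReal.coe_neg]
    refine le_trans (EReal.coe_le_coe_iff.2 ?_) h1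
    linarith
  · exact (ENNReal.continuous_exp.tendsto _).comp
      ((continuous_neg.tendsto _).comp (tendsto_conj_addSq h x))

/-- The inverse Santaló inequality passes from the regularizations of `f` to `f`. -/
theorem le_expInt_mul_expInt_conj_of_regularize {A : ℝ≥0∞} {f : Rn n → EReal}
    (hf : f ∈ classF n) (hpos : 0 < expInt f) (hpos' : 0 < expInt (conj f))
    (h : ∀ ε : ℝ, 0 < ε → regularize ε (conj f) ∈ classV n →
      A ≤ expInt (regularize ε (conj f)) * expInt (conj (regularize ε (conj f)))) :
    A ≤ expInt f * expInt (conj f) := by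
  by_cases hfin : expInt f = ∞
  · rw [hfin, ENNReal.top_mul hpos'.ne']
    exact le_top
  by_cases hfin' : expInt (conj f) = ∞
  · rw [hfin', ENNReal.mul_top hpos.ne']
    exact le_top
  obtain ⟨x₀, hx₀⟩ := exists_ne_top_of_expInt_pos hpos
  obtain ⟨y₀, hy₀⟩ := exists_ne_top_of_expInt_pos hpos'
  have hff : conj (conj f) = f := conj_conj hf hy₀
  obtain ⟨a, b, ha, hab⟩ := exists_le_of_zero_mem_interior_dom hf.2.1 hf.1
    (zero_mem_interior_dom hf.2.1 hpos hpos' hfin')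
  obtain ⟨a', b', ha', hab'⟩ := exists_le_of_zero_mem_interior_dom (isConvexFn_conj f)
    (fun y => conj_ne_bot hx₀ y) (zero_mem_interior_dom (isConvexFn_conj f) hpos'
      (by rwa [hff]) (by rwa [hff]))
  have hlim := tendsto_expInt_conj_addSq ha' hab'
  rw [hff] at hlim
  refine ge_of_tendsto' (ENNReal.Tendsto.mul hlim (Or.inl hpos.ne')
    (tendsto_expInt_conj_addSq ha hab) (Or.inl hpos'.ne')) fun k => ?_
  have hε : 0 < 1 / ((k : ℝ) + 1) := Nat.one_div_pos_of_nat
  refine (h _ hε (regularize_mem_classV hy₀ (by rwa [hff]) hε)).trans (mul_le_mul' ?_ ?_)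
  · exact expInt_anti fun x => conj_addSq_le_regularize hε.le _ x
  · refine expInt_anti fun y => ?_
    have h1 := conj_addSq_conj_le_conj_regularize hε.le (conj f) y
    rwa [hff] at h1

end EntropyTransport

end

theorem corollary2p3 (n : ℕ) (c : ℝ) (hc : 0 < c) :
    (∀ V ∈ EntropyTransport.classV n, EntropyTransport.EntropyTransportIneq c V →
      ENNReal.ofReal (c ^ n) ≤
        EntropyTransport.expInt V * EntropyTransport.expInt (EntropyTransport.conj V)) ∧
    ((∀ V ∈ EntropyTransport.classV n, EntropyTransport.EntropyTransportIneq c V) →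
      EntropyTransport.InverseSantalo n c) ∧
    ((∀ V ∈ EntropyTransport.classV n, EntropyTransport.IsEven V →
        EntropyTransport.EntropyTransportIneq c V) →
      EntropyTransport.InverseSantaloSymm n c) := by
  refine ⟨fun V hV h => EntropyTransport.le_expInt_mul_expInt_conj hc hV h,
    fun h f hf hpos hpos' => ?_, fun h f hf heven hpos hpos' => ?_⟩
  · exact EntropyTransport.le_expInt_mul_expInt_conj_of_regularize hf hpos hpos' fun ε _ hV =>
      EntropyTransport.le_expInt_mul_expInt_conj hc hV (h _ hV)
  · exact EntropyTransport.le_expInt_mul_expInt_conj_of_regularize hf hpos hpos' fun ε _ hV =>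
      EntropyTransport.le_expInt_mul_expInt_conj hc hV (h _ hV (heven.conj.regularize ε))
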